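/- Let $C(x)$ denote plain Kolmogorov complexity and $C(x\mid y)$ conditional plain Kolmogorov complexity of binary strings, taken with respect to fixed universal machines: for a machine (partial computable function) $M$, $C_M(x)=\min\{|p| : M(p)=x\}$ and $C_M(x\mid y)=\min\{|p| : M(p,y)=x\}$ (with $\min\emptyset=\infty$), and $U$ is universal if for every machine $M$ there is a constant $c_M$ with $C_U(x)\le C_M(x)+c_M$ for all $x$ (respectively $C_U(x\mid y)\le C_M(x\mid y)+c_M$ for all $x,y$). In $C(y\mid n)$ the number $n$ is given by its binary expansion, and $\log$ is the logarithm to base $2$. For $x\in\{0,1\}^n$ and $a\in\mathbb{N}$ let $$B_{x,a}=\{\,y\in\{0,1\}^n : C(y\mid n)-C(y\mid x)\ge a\,\}.$$ Theorem. There is a constant $C>0$ (depending only on the chosen universal machines) such that for every computable function $\alpha:\mathbb{N}\to\mathbb{N}$ and for every sufficiently large $n$ (depending on $\alpha$), every $x\in\{0,1\}^n$ with $C(x)\ge\alpha(n)+8\log n$ satisfies $$|B_{x,\alpha(n)}|\ \ge\ \frac{1}{C}\,2^{\,n-\alpha(n)}-n^{8}\,2^{\alpha(n)}.$$ -/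

import Mathlib

/-- `plainK M x` is the plain Kolmogorov complexity of the binary string `x` with respect to the
machine `M` (a partial function on binary strings): the least length of a program `p` with
`M(p) = x`, and `⊤` if there is no such program. -/
noncomputable def plainK (M : List Bool →. List Bool) (x : List Bool) : ℕ∞ :=
  ⨅ p ∈ {p : List Bool | x ∈ M p}, (p.length : ℕ∞)

/-- `condK M x y` is the Kolmogorov complexity of `x` conditioned by `y` with respect to the
machine `M` with two inputs: the least length of a program `p` with `M(p, y) = x`, and `⊤` if there
is no such program. -/
noncomputable def condK (M : List Bool → List Bool →. List Bool) (x y : List Bool) : ℕ∞ :=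
  ⨅ p ∈ {p : List Bool | x ∈ M p y}, (p.length : ℕ∞)

/-- `U` is a universal machine for plain complexity: it is a machine, and up to an additive
constant its complexity is at most that of any other machine. -/
def IsUniversal (U : List Bool →. List Bool) : Prop :=
  Partrec U ∧ ∀ M : List Bool →. List Bool, Partrec M →
    ∃ c : ℕ, ∀ x : List Bool, plainK U x ≤ plainK M x + c

/-- `U` is a universal machine for conditional complexity. -/
def IsCondUniversal (U : List Bool → List Bool →. List Bool) : Prop :=
  Partrec₂ U ∧ ∀ M : List Bool → List Bool →. List Bool, Partrec₂ M →
    ∃ c : ℕ, ∀ x y : List Bool, condK U x y ≤ condK M x y + c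

/-- Complexities with respect to a universal machine are finite. -/
theorem plainK_ne_top {U : List Bool →. List Bool} (hU : IsUniversal U) (x : List Bool) :
    plainK U x ≠ ⊤ := by
  obtain ⟨c, hc⟩ := hU.2 (fun p => Part.some p) Computable.id.partrec
  have h : plainK (fun p => Part.some p) x ≤ (x.length : ℕ∞) :=
    iInf₂_le (f := fun (p : List Bool) _ => (p.length : ℕ∞)) x (Part.mem_some x)
  refine ne_top_of_le_ne_top ?_ ((hc x).trans (add_le_add_left h (c : ℕ∞)))
  exact_mod_cast ENat.natCast_ne_top (x.length + c)

/-- Conditional complexities with respect to a universal machine are finite. -/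
theorem condK_ne_top {U : List Bool → List Bool →. List Bool} (hU : IsCondUniversal U)
    (x y : List Bool) : condK U x y ≠ ⊤ := by
  obtain ⟨c, hc⟩ := hU.2 (fun p _ => Part.some p) Computable.fst.partrec
  have h : condK (fun p _ => Part.some p) x y ≤ (x.length : ℕ∞) :=
    iInf₂_le (f := fun (p : List Bool) _ => (p.length : ℕ∞)) x (Part.mem_some x)
  refine ne_top_of_le_ne_top ?_ ((hc x y).trans (add_le_add_left h (c : ℕ∞)))
  exact_mod_cast ENat.natCast_ne_top (x.length + c)

/-- The binary expansion of `n` as a string, most significant bit first; it is what "given `n`"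
means in a conditional complexity `C(y ∣ n)`. -/
def binString (n : ℕ) : List Bool := (Nat.bits n).reverse

/-- The set `B_{x,a}` of the strings `y` of the same length `n` as `x` with
`C(y ∣ n) - C(y ∣ x) ≥ a` (as integers; both complexities are finite when `U` is universal). -/
def depSet (U : List Bool → List Bool →. List Bool) (x : List Bool) (a : ℕ) : Set (List Bool) :=
  {y | y.length = x.length ∧
    (a : ℤ) ≤ ((condK U y (binString x.length)).toNat : ℤ) - ((condK U y x).toNat : ℤ)}

/-! Strings `y` that depend on `x` are produced by hashing. With a seed `s` of length `l = n - α(n)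
- d`, where `d` is a constant, put `y = seedHash s x`: the seed followed by `n - l` bits of a hash
of `x`. Given `x`, the seed describes `y`, so `C(y | x) ≤ l + O(1)`. If `y` cannot be compressed by
more than 6 bits given `n`, the difference of the two complexities is at least `α(n)` for a suitable
`d`. Distinct seeds give distinct `y`, so `x` satisfies the bound as soon as half of its hashes are
incompressible in this sense (`two_pow_le_ncard_depSet`).

The remaining `x`, the `MostlyCompressible` ones, are few and enumerable. They are few by a second
moment argument: the set of compressible strings has density at most `2^(-6)`, and a family with few
collisions cannot send half of the seeds into so sparse a set for more than `2^(n - l)` words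
(`card_le_of_seedHash_mem`). They are enumerable from `n` because compressibility is semidecidable
and `α` is computable. Hence such an `x` is described by `n` and its index in the enumeration, and
`C(x) ≤ 2 log n + α(n) + O(1)` (`plainK_le_of_mostlyCompressible`), against the hypothesis on
`C(x)`.

The hash needs `n ≤ 2 * l`. Otherwise `α(n)` is about `n / 2` or more, and the subtracted term `n^8
2^α(n)` makes the claim trivial. -/

/-! ### Binary words and natural numbers -/

/-- The value of a binary word, least significant bit first. -/
def wordVal (l : List Bool) : ℕ := l.foldr (fun b v => b.toNat + 2 * v) 0

/-- The `n` lowest binary digits of `k`, least significant bit first. -/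
def natWord : ℕ → ℕ → List Bool
  | 0, _ => []
  | n + 1, k => (k % 2 == 1) :: natWord n (k / 2)

@[simp] theorem wordVal_nil : wordVal [] = 0 := rfl

@[simp] theorem wordVal_cons (b : Bool) (l : List Bool) :
    wordVal (b :: l) = b.toNat + 2 * wordVal l := rfl

@[simp] theorem length_natWord (n k : ℕ) : (natWord n k).length = n := by
  induction n generalizing k with
  | zero => rfl
  | succ n ih => simp [natWord, ih]

theorem wordVal_lt (l : List Bool) : wordVal l < 2 ^ l.length := by
  induction l with
  | nil => simp
  | cons b l ih =>
    have := b.toNat_le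
    rw [wordVal_cons, List.length_cons, pow_succ]
    omega

theorem natWord_wordVal (l : List Bool) : natWord l.length (wordVal l) = l := by
  induction l with
  | nil => rfl
  | cons b l ih =>
    have h : (b.toNat + 2 * wordVal l) / 2 = wordVal l := by cases b <;> simp <;> omega
    rw [List.length_cons, natWord, wordVal_cons, h, ih]
    cases b <;> simp [Nat.add_mod]

theorem wordVal_natWord {n k : ℕ} (h : k < 2 ^ n) : wordVal (natWord n k) = k := by
  induction n generalizing k with
  | zero => simp at h; simp [natWord, h]
  | succ n ih =>
    rw [natWord, wordVal_cons, ih (by rw [pow_succ] at h; omega)]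
    rcases Nat.mod_two_eq_zero_or_one k with h2 | h2 <;> (simp [h2]; omega)

theorem wordVal_bits (n : ℕ) : wordVal (Nat.bits n) = n := by
  induction n using Nat.binaryRec' with
  | zero => simp
  | bit b n h ih =>
    rw [Nat.bits_append_bit n b h, wordVal_cons, ih, Nat.bit_val]
    ring

theorem natWord_eq_map (n k : ℕ) :
    natWord n k = (List.range n).map fun i => k / 2 ^ i % 2 == 1 := by
  induction n generalizing k with
  | zero => rfl
  | succ n ih =>
    rw [natWord, ih, List.range_succ_eq_map, List.map_cons, List.map_map]
    simp [Function.comp_def, pow_succ', Nat.div_div_eq_div_mul]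

theorem primrec_nat_pow : Primrec₂ ((· ^ ·) : ℕ → ℕ → ℕ) :=
  Primrec₂.unpaired'.1 Nat.Primrec.pow

theorem primrec_wordVal : Primrec wordVal := by
  have hb : Primrec Bool.toNat := Primrec.dom_finite _
  exact Primrec.list_foldr Primrec.id (Primrec.const 0)
    (Primrec.nat_add.comp (hb.comp (Primrec.fst.comp Primrec.snd))
      (Primrec.nat_mul.comp (Primrec.const 2) (Primrec.snd.comp Primrec.snd))).to₂

theorem primrec_natWord : Primrec₂ natWord := by
  have h : Primrec₂ fun (a : ℕ × ℕ) (i : ℕ) => (a.2 / 2 ^ i % 2 == 1) :=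
    Primrec.beq.comp (Primrec.nat_mod.comp (Primrec.nat_div.comp (Primrec.snd.comp Primrec.fst)
      (primrec_nat_pow.comp (Primrec.const 2) Primrec.snd)) (Primrec.const 2)) (Primrec.const 1)
  exact (Primrec.list_map (Primrec.list_range.comp Primrec.fst) h).of_eq
    fun a => (natWord_eq_map a.1 a.2).symm

theorem wordVal_injOn (n : ℕ) : Set.InjOn wordVal {l | l.length = n} := by
  intro l hl l' hl' h
  have hn : l.length = l'.length := Eq.trans hl (Eq.symm hl')
  have := natWord_wordVal l
  rw [h, hn, natWord_wordVal] at this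
  exact this.symm

theorem card_le_of_length_lt (n : ℕ) (T : Finset (List Bool)) (hT : ∀ l ∈ T, l.length < n) :
    T.card ≤ 2 ^ n := by
  rw [← Finset.card_range (2 ^ n)]
  -- The appended top bit makes the value injective across different lengths.
  refine Finset.card_le_card_of_injOn (fun l => wordVal (l ++ [true]) ) (fun l hl => ?_) ?_
  · have := wordVal_lt (l ++ [true])
    rw [List.length_append] at this
    have h2 := Nat.pow_le_pow_right (n := 2) (by norm_num) (hT l hl)
    simp only [Finset.coe_range, Set.mem_Iio]
    exact this.trans_le h2
  · have key : ∀ l l' : List Bool, wordVal (l ++ [true]) = wordVal (l' ++ [true]) → l = l' := by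
      intro l
      induction l with
      | nil =>
        intro l' h
        cases l' with
        | nil => rfl
        | cons b l' =>
          exfalso
          have h0 : 0 < wordVal (l' ++ [true]) := by
            clear h
            induction l' with
            | nil => simp
            | cons c l' ih => simp only [List.cons_append, wordVal_cons]; omega
          simp only [List.nil_append, List.cons_append, wordVal_cons, wordVal_nil] at h
          cases b <;> simp at h <;> omega
      | cons a l ih =>
        intro l' h
        cases l' with
        | nil =>
          exfalso
          have h0 : 0 < wordVal (l ++ [true]) := by
            clear h ih
            induction l with
            | nil => simp
            | cons c l' ih => simp only [List.cons_append, wordVal_cons]; omega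
          simp only [List.nil_append, List.cons_append, wordVal_cons, wordVal_nil] at h
          cases a <;> simp at h <;> omega
        | cons b l' =>
          simp only [List.cons_append, wordVal_cons] at h
          have hab : a = b ∧ wordVal (l ++ [true]) = wordVal (l' ++ [true]) := by
            cases a <;> cases b <;> simp at h ⊢ <;> omega
          rw [hab.1, ih _ hab.2]
    exact fun l _ l' _ h => key l l' h

/-! ### A computable sequence of primes -/

/-- The largest prime that is at most `2 ^ (l + 1)`. -/
def dyadicPrime (l : ℕ) : ℕ := Nat.findGreatest Nat.Prime (2 ^ (l + 1))

theorem primrecPred_prime : PrimrecPred Nat.Prime := by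
  have h1 : PrimrecRel fun m p : ℕ => m < 2 ∨ ¬ p % m = 0 :=
    ((Primrec.nat_lt.comp Primrec.fst (Primrec.const 2)).or
      (PrimrecPred.not (Primrec.eq.comp (Primrec.nat_mod.comp Primrec.snd Primrec.fst)
        (Primrec.const 0))))
  have h2 : PrimrecPred fun p : ℕ => 2 ≤ p ∧ ∀ m < p, m < 2 ∨ ¬ p % m = 0 :=
    (Primrec.nat_le.comp (Primrec.const 2) Primrec.id).and
      ((PrimrecRel.forall_lt h1).comp Primrec.id Primrec.id)
  refine h2.of_eq fun p => ?_
  rw [Nat.prime_def_lt']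
  refine and_congr_right fun _ => ⟨fun h m h2 hm hd => ?_, fun h m hm => ?_⟩
  · exact (h m hm).elim (fun h => by omega) fun h => h (Nat.mod_eq_zero_of_dvd hd)
  · rcases lt_or_ge m 2 with h2 | h2
    · exact Or.inl h2
    · exact Or.inr fun h0 => h m h2 hm (Nat.dvd_of_mod_eq_zero h0)

theorem primrec_dyadicPrime : Primrec dyadicPrime :=
  Primrec.nat_findGreatest (primrec_nat_pow.comp (Primrec.const 2) Primrec.succ)
    (primrecPred_prime.comp Primrec.snd)

/-- Bertrand's postulate. The lower bound lets two base-`p` digits hold `2 * l` bits; the upper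
bound controls the length of the rounded hash. -/
theorem dyadicPrime_spec (l : ℕ) :
    (dyadicPrime l).Prime ∧ 2 ^ l < dyadicPrime l ∧ dyadicPrime l ≤ 2 ^ (l + 1) := by
  obtain ⟨p, hp, h1, h2⟩ := Nat.exists_prime_lt_and_le_two_mul (2 ^ l) (by positivity)
  rw [← pow_succ'] at h2
  exact ⟨Nat.findGreatest_spec h2 hp, h1.trans_le (Nat.le_findGreatest h2 hp),
    Nat.findGreatest_le _⟩

/-! ### A hash family with short seeds -/

/-- The hash of `x` with seed `s` modulo `p`: the base-`p` digits of `x` are the coefficients of a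
polynomial of degree two without constant term, whose value at `s` is rounded to multiples
of `q`. -/
def quadHash (p q x s : ℕ) : ℕ := (x % p * s + x / p * s ^ 2) % p / q

theorem card_quadratic_roots_le {p : ℕ} [Fact p.Prime] {a b : ZMod p} (h : a ≠ 0 ∨ b ≠ 0)
    (c : ZMod p) (N : ℕ) (hN : N ≤ p) :
    ((Finset.range N).filter fun s : ℕ => a * s + b * (s : ZMod p) ^ 2 = c).card ≤ 2 := by
  classical
  let f : Polynomial (ZMod p) := Polynomial.C b * Polynomial.X ^ 2 + Polynomial.C a * Polynomial.X
    + Polynomial.C (-c)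
  have hf : f ≠ 0 := by
    intro h0
    have h1 : f.coeff 1 = a := by simp [f, Polynomial.coeff_C]
    have h2 : f.coeff 2 = b := by simp [f]
    rw [h0] at h1 h2
    simp at h1 h2
    rcases h with h | h
    · exact h h1.symm
    · exact h h2.symm
  have hdeg : f.natDegree ≤ 2 := Polynomial.natDegree_quadratic_le
  refine le_trans ?_ (hdeg.trans' ((Multiset.toFinset_card_le _).trans f.card_roots'))
  refine Finset.card_le_card_of_injOn (fun s : ℕ => (s : ZMod p)) (fun s hs => ?_) ?_
  · have hs' := (Finset.mem_filter.1 hs).2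
    simp only [Finset.mem_coe, Multiset.mem_toFinset, Polynomial.mem_roots hf, Polynomial.IsRoot]
    simp only [f, Polynomial.eval_add, Polynomial.eval_mul, Polynomial.eval_C, Polynomial.eval_pow,
      Polynomial.eval_X]
    rw [← hs']
    ring
  · intro s hs t ht hst
    have hs' := Finset.mem_range.1 (Finset.mem_filter.1 hs).1
    have ht' := Finset.mem_range.1 (Finset.mem_filter.1 ht).1
    have := (ZMod.natCast_eq_natCast_iff' s t p).1 hst
    rwa [Nat.mod_eq_of_lt (by omega), Nat.mod_eq_of_lt (by omega)] at this

/-- Equal rounded values mean that the residues differ by some `j` with `|j| < q`. For each of these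
`2 * q - 1` values the seed is a root of a nonzero quadratic over `ZMod p`. A constant term in the
hash would spoil this: words differing only there would have a constant difference. -/
theorem card_quadHash_collisions_le {p q x y N : ℕ} (hp : p.Prime) (hq : 0 < q) (hN : N ≤ p)
    (hx : x < p ^ 2) (hy : y < p ^ 2) (hxy : x ≠ y) :
    ((Finset.range N).filter fun s => quadHash p q x s = quadHash p q y s).card ≤ 4 * q := by
  classical
  have : Fact p.Prime := ⟨hp⟩
  set a : ZMod p := ((x % p : ℕ) : ZMod p) - ((y % p : ℕ) : ZMod p) with ha
  set b : ZMod p := ((x / p : ℕ) : ZMod p) - ((y / p : ℕ) : ZMod p) with hb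
  have hab : a ≠ 0 ∨ b ≠ 0 := by
    by_contra! h
    have h1 := (ZMod.natCast_eq_natCast_iff' _ _ p).1 (sub_eq_zero.1 h.1)
    have h2 := (ZMod.natCast_eq_natCast_iff' _ _ p).1 (sub_eq_zero.1 h.2)
    rw [Nat.mod_mod, Nat.mod_mod] at h1
    rw [sq] at hx hy
    rw [Nat.mod_eq_of_lt (Nat.div_lt_of_lt_mul hx), Nat.mod_eq_of_lt (Nat.div_lt_of_lt_mul hy)]
      at h2
    apply hxy
    rw [← Nat.mod_add_div x p, ← Nat.mod_add_div y p, h1, h2]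
  let J : Finset ℤ := Finset.Ioo (-(q : ℤ)) q
  have hsub : ((Finset.range N).filter fun s => quadHash p q x s = quadHash p q y s) ⊆
      J.biUnion fun j => (Finset.range N).filter
        fun s : ℕ => a * s + b * (s : ZMod p) ^ 2 = (j : ZMod p) := by
    intro s hs
    obtain ⟨hs1, hs2⟩ := Finset.mem_filter.1 hs
    unfold quadHash at hs2
    set u := x % p * s + x / p * s ^ 2 with hu
    set v := y % p * s + y / p * s ^ 2 with hv
    refine Finset.mem_biUnion.2 ⟨((u % p : ℕ) : ℤ) - ((v % p : ℕ) : ℤ), ?_, ?_⟩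
    · have h1 := Nat.div_add_mod (u % p) q
      have h2 := Nat.div_add_mod (v % p) q
      have h3 := Nat.mod_lt (u % p) hq
      have h4 := Nat.mod_lt (v % p) hq
      rw [hs2] at h1
      simp only [J, Finset.mem_Ioo]
      omega
    · refine Finset.mem_filter.2 ⟨hs1, ?_⟩
      push_cast
      rw [ha, hb, hu, hv]
      push_cast
      ring
  refine (Finset.card_le_card hsub).trans ((Finset.card_biUnion_le_card_mul _ _ 2
    fun j _ => card_quadratic_roots_le hab _ N hN).trans ?_)
  simp only [J, Int.card_Ioo]
  omega

theorem primrec_quadHash {γ : Type*} [Primcodable γ] {p q x s : γ → ℕ} (hp : Primrec p)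
    (hq : Primrec q) (hx : Primrec x) (hs : Primrec s) :
    Primrec fun a => quadHash (p a) (q a) (x a) (s a) :=
  Primrec.nat_div.comp (Primrec.nat_mod.comp (Primrec.nat_add.comp
    (Primrec.nat_mul.comp (Primrec.nat_mod.comp hx hp) hs)
    (Primrec.nat_mul.comp (Primrec.nat_div.comp hx hp)
      (primrec_nat_pow.comp hs (Primrec.const 2)))) hp) hq

/-- The word `s` followed by a hash of `x` with seed `s`, such that the result is as long
as `x`. -/
def seedHash (s x : List Bool) : List Bool :=
  s ++ natWord (x.length - s.length) (quadHash (dyadicPrime s.length)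
    (2 ^ (2 * s.length + 1 - x.length)) (wordVal x) (wordVal s))

theorem length_seedHash {s x : List Bool} (h : s.length ≤ x.length) :
    (seedHash s x).length = x.length := by
  simp [seedHash, h]

theorem primrec_seedHash : Primrec₂ seedHash := by
  have hs : Primrec fun a : List Bool × List Bool => a.1.length := Primrec.list_length.comp .fst
  have hx : Primrec fun a : List Bool × List Bool => a.2.length := Primrec.list_length.comp .snd
  exact Primrec.list_append.comp .fst (primrec_natWord.comp (Primrec.nat_sub.comp hx hs)
    (primrec_quadHash (primrec_dyadicPrime.comp hs)
      (primrec_nat_pow.comp (.const 2) (Primrec.nat_sub.comp (Primrec.nat_add.comp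
        (Primrec.nat_mul.comp (.const 2) hs) (.const 1)) hx))
      (primrec_wordVal.comp .snd) (primrec_wordVal.comp .fst)))

theorem seedHash_left_injective {s t x y : List Bool} (hst : s.length = t.length)
    (h : seedHash s x = seedHash t y) : s = t :=
  (List.append_inj h hst).1

theorem card_seedHash_collisions_le {n l : ℕ} (hln : l ≤ n) (hnl : n ≤ 2 * l) {x y : List Bool}
    (hx : x.length = n) (hy : y.length = n) (hxy : x ≠ y) :
    ((Finset.range (2 ^ l)).filter fun s =>
      seedHash (natWord l s) x = seedHash (natWord l s) y).card ≤ 4 * 2 ^ (2 * l + 1 - n) := by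
  obtain ⟨hp, hp1, hp2⟩ := dyadicPrime_spec l
  have hlt : ∀ z : List Bool, z.length = n → wordVal z < dyadicPrime l ^ 2 := fun z hz =>
    calc wordVal z < 2 ^ n := hz ▸ wordVal_lt z
      _ ≤ 2 ^ (l * 2) := Nat.pow_le_pow_right (by norm_num) (by omega)
      _ = (2 ^ l) ^ 2 := pow_mul _ _ _
      _ ≤ dyadicPrime l ^ 2 := Nat.pow_le_pow_left hp1.le 2
  have hne : wordVal x ≠ wordVal y := fun h => hxy (wordVal_injOn n hx hy h)
  refine (Finset.card_le_card fun s hs => ?_).trans (card_quadHash_collisions_le hp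
    (q := 2 ^ (2 * l + 1 - n)) (by positivity) hp1.le (hlt x hx) (hlt y hy) hne)
  obtain ⟨hs1, hs2⟩ := Finset.mem_filter.1 hs
  refine Finset.mem_filter.2 ⟨hs1, ?_⟩
  have hbound : ∀ z, quadHash (dyadicPrime l) (2 ^ (2 * l + 1 - n)) z s < 2 ^ (n - l) := by
    intro z
    refine Nat.div_lt_of_lt_mul ((Nat.mod_lt _ hp.pos).trans_le ?_)
    rw [← pow_add]
    exact hp2.trans (Nat.pow_le_pow_right (by norm_num) (by omega))
  simp only [seedHash, length_natWord, hx, hy,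
    wordVal_natWord (Finset.mem_range.1 hs1)] at hs2
  have := congrArg wordVal (List.append_cancel_left hs2)
  rwa [wordVal_natWord (hbound _), wordVal_natWord (hbound _)] at this

/-! ### A second moment bound -/

/-- Cauchy–Schwarz over the fibres above `B`: at least half of all pairs `(x, s)` land in `B`, while
the pairs sharing a value number at most `X.card * (S.card + X.card * E)`, the first summand being
the diagonal. -/
theorem card_mul_sq_le_of_collisions {α σ β : Type*} [DecidableEq β]
    (X : Finset α) (S : Finset σ) (B : Finset β) (f : σ → α → β) (E : ℕ)
    (hf : ∀ s ∈ S, ∀ t ∈ S, ∀ x y, f s x = f t y → s = t)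
    (hE : ∀ x ∈ X, ∀ y ∈ X, x ≠ y → (S.filter fun s => f s x = f s y).card ≤ E)
    (hB : ∀ x ∈ X, S.card ≤ 2 * (S.filter fun s => f s x ∈ B).card) :
    X.card * S.card ^ 2 ≤ 4 * B.card * (S.card + X.card * E) := by
  classical
  rcases X.eq_empty_or_nonempty with rfl | hX
  · simp
  let T : Finset (α × σ) := (X ×ˢ S).filter fun t => f t.2 t.1 ∈ B
  let F : β → Finset (α × σ) := fun b => T.filter fun t => f t.2 t.1 = b
  let Q : Finset ((α × α) × σ) := ((X ×ˢ X) ×ˢ S).filter fun t => f t.2 t.1.1 = f t.2 t.1.2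
  have hT : X.card * S.card ≤ 2 * T.card := by
    have h1 : T.card = ∑ x ∈ X, (S.filter fun s => f s x ∈ B).card := by
      simp only [T, Finset.card_filter, Finset.sum_product]
    rw [h1, Finset.mul_sum, ← smul_eq_mul]
    exact Finset.card_nsmul_le_sum _ _ _ hB
  have hTF : T.card = ∑ b ∈ B, (F b).card :=
    Finset.card_eq_sum_card_fiberwise fun t ht => (Finset.mem_filter.1 ht).2
  have hCS : T.card ^ 2 ≤ B.card * ∑ b ∈ B, (F b).card ^ 2 := by
    rw [hTF]
    exact sq_sum_le_card_mul_sum_sq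
  have hFQ : ∑ b ∈ B, (F b).card ^ 2 ≤ Q.card := by
    have h1 : ∑ b ∈ B, (F b).card ^ 2 = (B.sigma fun b => F b ×ˢ F b).card := by
      simp [Finset.card_sigma, sq]
    rw [h1]
    have hmem : ∀ u ∈ B.sigma fun b => F b ×ˢ F b,
        (u.2.1.1 ∈ X ∧ u.2.1.2 ∈ S ∧ f u.2.1.2 u.2.1.1 = u.1) ∧
        (u.2.2.1 ∈ X ∧ u.2.2.2 ∈ S ∧ f u.2.2.2 u.2.2.1 = u.1) := by
      intro u hu
      simp only [F, T, Finset.mem_sigma, Finset.mem_product, Finset.mem_filter] at hu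
      tauto
    refine Finset.card_le_card_of_injOn (fun u => ((u.2.1.1, u.2.2.1), u.2.1.2)) ?_ ?_
    · intro u hu
      obtain ⟨⟨h1, h2, h3⟩, h4, h5, h6⟩ := hmem u hu
      have hs := hf _ h2 _ h5 _ _ (h3.trans h6.symm)
      refine Finset.mem_filter.2 ⟨Finset.mem_product.2 ⟨Finset.mem_product.2 ⟨h1, h4⟩, h2⟩, ?_⟩
      simp only
      rw [h3, hs, h6]
    · intro u hu v hv huv
      obtain ⟨⟨h1, h2, h3⟩, h4, h5, h6⟩ := hmem u hu
      obtain ⟨⟨k1, k2, k3⟩, k4, k5, k6⟩ := hmem v hv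
      -- Equal values force equal seeds, so a pair in one fibre is a collision for a single seed.
      have hs := hf _ h2 _ h5 _ _ (h3.trans h6.symm)
      have ks := hf _ k2 _ k5 _ _ (k3.trans k6.symm)
      obtain ⟨b, ⟨x, s⟩, y, t⟩ := u
      obtain ⟨b', ⟨x', s'⟩, y', t'⟩ := v
      simp only [Prod.mk.injEq] at *
      obtain ⟨⟨rfl, rfl⟩, rfl⟩ := huv
      subst hs ks h3 k3
      rfl
  have hQ : Q.card ≤ X.card * (S.card + X.card * E) := by
    have h1 : Q.card = ∑ x ∈ X, ∑ y ∈ X, (S.filter fun s => f s x = f s y).card := by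
      simp only [Q, Finset.card_filter, Finset.sum_product]
    rw [h1, ← smul_eq_mul]
    refine Finset.sum_le_card_nsmul _ _ _ fun x hx => ?_
    calc ∑ y ∈ X, (S.filter fun s => f s x = f s y).card
        ≤ ∑ y ∈ X, ((if x = y then S.card else 0) + E) := by
          refine Finset.sum_le_sum fun y hy => ?_
          split_ifs with h
          · exact (Finset.card_filter_le _ _).trans (Nat.le_add_right _ _)
          · simpa using hE x hx y hy h
      _ = S.card + X.card * E := by
          rw [Finset.sum_add_distrib, Finset.sum_ite_eq, if_pos hx, Finset.sum_const, smul_eq_mul]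
  have hXpos := hX.card_pos
  refine Nat.le_of_mul_le_mul_left ?_ hXpos
  calc X.card * (X.card * S.card ^ 2) = (X.card * S.card) ^ 2 := by ring
    _ ≤ (2 * T.card) ^ 2 := Nat.pow_le_pow_left hT 2
    _ = 4 * T.card ^ 2 := by ring
    _ ≤ 4 * (B.card * Q.card) :=
      Nat.mul_le_mul_left _ (hCS.trans (Nat.mul_le_mul_left _ hFQ))
    _ ≤ 4 * (B.card * (X.card * (S.card + X.card * E))) :=
      Nat.mul_le_mul_left _ (Nat.mul_le_mul_left _ hQ)
    _ = X.card * (4 * B.card * (S.card + X.card * E)) := by ring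

/-- The 6 is chosen here: the collision term is at most `4 * 2^(n-6) * 8 * 2^(2*l-n) = 2^(2*l) / 2`
per element of `X`, so it is absorbed by the left side of the second moment bound. -/
theorem card_le_of_seedHash_mem {n l : ℕ} (hn : 6 ≤ n) (hln : l ≤ n) (hnl : n ≤ 2 * l)
    (B X : Finset (List Bool)) (hB : B.card ≤ 2 ^ (n - 6)) (hX : ∀ x ∈ X, x.length = n)
    (hXB : ∀ x ∈ X, 2 ^ l ≤
      2 * ((Finset.range (2 ^ l)).filter fun s => seedHash (natWord l s) x ∈ B).card) :
    X.card ≤ 2 ^ (n - l) := by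
  have h := card_mul_sq_le_of_collisions X (Finset.range (2 ^ l)) B
    (fun s x => seedHash (natWord l s) x) (4 * 2 ^ (2 * l + 1 - n))
    (fun s hs t ht x y hst => by
      have := congrArg wordVal (seedHash_left_injective (by simp) hst)
      rwa [wordVal_natWord (Finset.mem_range.1 hs), wordVal_natWord (Finset.mem_range.1 ht)]
        at this)
    (fun x hx y hy hxy => card_seedHash_collisions_le hln hnl (hX x hx) (hX y hy) hxy)
    (fun x hx => by simpa using hXB x hx)
  rw [Finset.card_range] at h
  obtain ⟨i, rfl⟩ : ∃ i, n = i + 6 := ⟨n - 6, by omega⟩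
  obtain ⟨j, hj⟩ : ∃ j, 2 * l = i + 6 + j := ⟨2 * l - (i + 6), by omega⟩
  obtain ⟨m, hm⟩ : ∃ m, i + 6 = l + m := ⟨i + 6 - l, by omega⟩
  have e1 : 2 * l + 1 - (i + 6) = j + 1 := by omega
  have e2 : i + 6 - l = m := by omega
  rw [e1, ← pow_mul, mul_comm l, hj] at h
  rw [e2]
  rw [Nat.add_sub_cancel] at hB
  have h2 := h.trans (Nat.mul_le_mul_right _ (Nat.mul_le_mul_left 4 hB))
  have h3 : (2 : ℕ) ^ l * 2 ^ m = 2 ^ i * 64 := by rw [← pow_add, ← hm, pow_add]; norm_num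
  have h4 : (2 : ℕ) ^ l * 2 ^ l = 2 ^ i * 64 * 2 ^ j := by
    rw [← pow_add, ← two_mul, hj, pow_add, pow_add]; norm_num
  rw [pow_add, pow_add, pow_succ] at h2
  have hl : (0 : ℕ) < 2 ^ l := by positivity
  have h5 : X.card * (2 ^ i * 32 * 2 ^ j) ≤ 2 ^ l * (2 ^ i * 4) := by
    ring_nf at h2 ⊢
    omega
  have h6 : 2 ^ l * (X.card * 2 ^ l) ≤ 2 ^ l * (2 * (2 ^ i * 4)) := by
    calc 2 ^ l * (X.card * 2 ^ l) = X.card * (2 ^ l * 2 ^ l) := by ring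
      _ = 2 * (X.card * (2 ^ i * 32 * 2 ^ j)) := by rw [h4]; ring
      _ ≤ 2 * (2 ^ l * (2 ^ i * 4)) := Nat.mul_le_mul_left _ h5
      _ = _ := by ring
  have h7 := Nat.le_of_mul_le_mul_left h6 hl
  refine Nat.le_of_mul_le_mul_left ?_ hl
  rw [h3]
  linarith [Nat.zero_le (2 ^ i)]

/-! ### Enumerations and plain complexity -/

theorem computable_count {γ : Type*} [Primcodable γ] {p : γ → ℕ → Bool} (hp : Computable₂ p) :
    Computable₂ fun a n => Nat.count (fun m => p a m = true) n := by
  have h : Computable₂ fun (a : γ × ℕ) (r : ℕ × ℕ) => r.2 + cond (p a.1 r.1) 1 0 :=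
    Primrec.nat_add.to_comp.comp (Computable.snd.comp .snd)
      (Computable.cond (hp.comp (Computable.fst.comp .fst) (Computable.fst.comp .snd))
        (Computable.const 1) (Computable.const 0))
  refine (Computable.nat_rec (f := fun a : γ × ℕ => a.2) .snd (Computable.const 0) h).of_eq ?_
  rintro ⟨a, n⟩
  simp only
  induction n with
  | zero => simp
  | succ n ih =>
    simp only [Nat.count_succ] at ih ⊢
    rw [ih]
    cases p a n <;> simp

/-- The enumeration `G b` with repetitions removed. -/
def firstOcc (G : List Bool → ℕ → Option (List Bool)) (b : List Bool) (z : ℕ) :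
    Option (List Bool) :=
  cond (Nat.count (fun w => decide (G b w = G b z) = true) z == 0) (G b z) none

theorem computable_firstOcc {G : List Bool → ℕ → Option (List Bool)} (hG : Computable₂ G) :
    Computable₂ (firstOcc G) := by
  have h : Computable₂ fun (a : List Bool × ℕ) (w : ℕ) => decide (G a.1 w = G a.1 a.2) :=
    Primrec.eq.decide.to_comp.comp (hG.comp (Computable.fst.comp .fst) .snd)
      (hG.comp (Computable.fst.comp .fst) (Computable.snd.comp .fst))
  exact Computable.cond (Primrec.beq.to_comp.comp
    ((computable_count h).comp .id .snd) (Computable.const 0)) hG (Computable.const none)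

theorem firstOcc_eq_some {G : List Bool → ℕ → Option (List Bool)} {b x : List Bool} {z : ℕ} :
    firstOcc G b z = some x ↔ G b z = some x ∧ ∀ w < z, G b w ≠ some x := by
  unfold firstOcc
  cases hc : (Nat.count (fun w => decide (G b w = G b z) = true) z == 0) with
  | false =>
    simp only [cond_false, reduceCtorEq, false_iff, not_and, not_forall, not_not]
    intro hx
    by_contra! hw
    have : Nat.count (fun w => decide (G b w = G b z) = true) z = 0 := by
      rw [Nat.count_eq_card_filter_range, Finset.card_eq_zero, Finset.filter_eq_empty_iff]
      intro w hw'
      simpa [hx] using hw w (Finset.mem_range.1 hw')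
    rw [this] at hc
    simp at hc
  | true =>
    simp only [cond_true]
    refine ⟨fun hx => ⟨hx, fun w hw hw' => ?_⟩, fun h => h.1⟩
    have h0 : Nat.count (fun w => decide (G b w = G b z) = true) z = 0 := by simpa using hc
    rw [Nat.count_eq_card_filter_range, Finset.card_eq_zero, Finset.filter_eq_empty_iff] at h0
    exact h0 (Finset.mem_range.2 hw) (by simp [hx, hw'])

/-- The word `b` and the number in the program `1^|b| 0 b i`. -/
def splitProgram (p : List Bool) : List Bool × ℕ :=
  let k := (p.takeWhile id).length
  ((p.drop (k + 1)).take k, wordVal ((p.drop (k + 1)).drop k))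

theorem primrec_splitProgram : Primrec splitProgram := by
  have hk : Primrec fun p : List Bool => (p.takeWhile id).length :=
    Primrec.list_length.comp (Primrec.list_takeWhile Primrec.id)
  have hd : Primrec fun p : List Bool => p.drop ((p.takeWhile id).length + 1) :=
    Primrec.list_drop.comp (Primrec.succ.comp hk) .id
  exact Primrec.pair (Primrec.list_take.comp hk hd)
    (primrec_wordVal.comp (Primrec.list_drop.comp hk hd))

theorem splitProgram_mk (b w : List Bool) :
    splitProgram (List.replicate b.length true ++ false :: (b ++ w)) = (b, wordVal w) := by
  have h : ((List.replicate b.length true ++ false :: (b ++ w)).takeWhile id)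
      = List.replicate b.length true := by
    rw [List.takeWhile_append_of_pos (by simp)]
    simp
  have hd : (List.replicate b.length true ++ false :: (b ++ w)).drop (b.length + 1) = b ++ w := by
    rw [List.drop_append]
    simp
  simp only [splitProgram, h, List.length_replicate, hd]
  simp

/-- A string is recovered from `b`, in self-delimiting form, and its rank among the first
occurrences, written in `L` bits. -/
theorem plainK_le_of_enumeration {U : List Bool →. List Bool} (hU : IsUniversal U)
    {G : List Bool → ℕ → Option (List Bool)} (hG : Computable₂ G) :
    ∃ c : ℕ, ∀ (b : List Bool) (L : ℕ) (T : Finset (List Bool)), T.card ≤ 2 ^ L →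
      (∀ z x, G b z = some x → x ∈ T) → ∀ z x, G b z = some x →
        plainK U x ≤ (2 * b.length + L + c : ℕ) := by
  let sel : List Bool → ℕ → Option (List Bool) := fun p z =>
    cond (Nat.count (fun w => (firstOcc G (splitProgram p).1 w).isSome = true) z
      == (splitProgram p).2) (firstOcc G (splitProgram p).1 z) none
  have hF : Computable₂ fun (p : List Bool) (z : ℕ) => firstOcc G (splitProgram p).1 z :=
    (computable_firstOcc hG).comp
      (Computable.fst.comp (primrec_splitProgram.to_comp.comp .fst)) .snd
  have hsel : Computable₂ sel :=
    Computable.cond (Primrec.beq.to_comp.comp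
      (computable_count (Primrec.option_isSome.to_comp.comp hF).to₂)
      (Computable.snd.comp (primrec_splitProgram.to_comp.comp .fst))) hF (Computable.const none)
  obtain ⟨c, hc⟩ := hU.2 (fun p => Nat.rfindOpt (sel p)) (Partrec.rfindOpt hsel)
  refine ⟨c + 1, fun b L T hT hGT z₀ x hz₀ => ?_⟩
  classical
  have hex : ∃ z, G b z = some x := ⟨z₀, hz₀⟩
  obtain ⟨z, hz⟩ : ∃ z, firstOcc G b z = some x :=
    ⟨Nat.find hex, firstOcc_eq_some.2 ⟨Nat.find_spec hex, fun w hw => Nat.find_min hex hw⟩⟩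
  let P : ℕ → Prop := fun w => (firstOcc G b w).isSome = true
  have hPz : P z := by simp [P, hz]
  have hlt : Nat.count P z < 2 ^ L := by
    refine lt_of_lt_of_le (Nat.count_strict_mono hPz (Nat.lt_succ_self z)) (le_trans ?_ hT)
    rw [Nat.count_eq_card_filter_range]
    refine Finset.card_le_card_of_injOn (fun w => (firstOcc G b w).getD []) ?_ ?_
    · intro w hw
      obtain ⟨y, hy⟩ := Option.isSome_iff_exists.1 (Finset.mem_filter.1 hw).2
      simpa [hy] using hGT w y (firstOcc_eq_some.1 hy).1
    · intro w hw w' hw' h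
      obtain ⟨y, hy⟩ := Option.isSome_iff_exists.1 (Finset.mem_filter.1 hw).2
      obtain ⟨y', hy'⟩ := Option.isSome_iff_exists.1 (Finset.mem_filter.1 hw').2
      have hyy : y = y' := by simpa [hy, hy'] using h
      subst hyy
      obtain ⟨h1, h2⟩ := firstOcc_eq_some.1 hy
      obtain ⟨h3, h4⟩ := firstOcc_eq_some.1 hy'
      rcases lt_trichotomy w w' with hl | hl | hl
      · exact absurd h1 (h4 w hl)
      · exact hl
      · exact absurd h3 (h2 w' hl)
  let p := List.replicate b.length true ++ false :: (b ++ natWord L (Nat.count P z))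
  have hsp : splitProgram p = (b, Nat.count P z) := by
    rw [splitProgram_mk, wordVal_natWord hlt]
  have hselz : sel p z = some x := by
    simp only [sel, hsp, hz]
    simp [P]
  have hmem : x ∈ Nat.rfindOpt (sel p) := by
    have hdom : (Nat.rfindOpt (sel p)).Dom := Nat.rfindOpt_dom.2 ⟨z, x, hselz⟩
    obtain ⟨y, hy⟩ := Part.dom_iff_mem.1 hdom
    obtain ⟨w, hw⟩ := Nat.rfindOpt_spec hy
    have hw' : sel p w = some y := hw
    simp only [sel, hsp] at hw'
    cases hcw : (Nat.count (fun w => (firstOcc G b w).isSome = true) w == Nat.count P z) with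
    | false => simp [hcw] at hw'
    | true =>
      rw [hcw, cond_true] at hw'
      have hPw : P w := by simp [P, hw']
      have hwz : w = z := Nat.count_injective hPw hPz (by simpa using hcw)
      rw [hwz, hz] at hw'
      rwa [Option.some.inj hw']
  have hlen : p.length = 2 * b.length + L + 1 := by simp [p]; ring
  calc plainK U x ≤ plainK (fun p => Nat.rfindOpt (sel p)) x + c := hc x
    _ ≤ (p.length : ℕ∞) + c := by
      gcongr
      exact iInf₂_le (f := fun (p : List Bool) _ => (p.length : ℕ∞)) p hmem
    _ = (2 * b.length + L + (c + 1) : ℕ) := by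
      rw [hlen]
      push_cast
      ring

/-! ### Words whose hashes are mostly compressible -/

open Nat.Partrec in
theorem exists_code_evaln {γ δ : Type*} [Primcodable γ] [Primcodable δ] {f : γ →. δ}
    (hf : Partrec f) :
    ∃ c : Code, ∀ a s, s ∈ f a ↔ ∃ k, Encodable.encode s ∈ Code.evaln k c (Encodable.encode a) := by
  obtain ⟨c, hc⟩ := Code.exists_code.1 hf
  refine ⟨c, fun a s => ?_⟩
  rw [← Code.evaln_complete, hc]
  simp [Encodable.encodek]

/-- `y` has a program given `b` that is shorter by more than six than `y`. -/
def Compressible (V : List Bool → List Bool →. List Bool) (b y : List Bool) : Prop :=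
  ∃ q : List Bool, q.length + 6 < y.length ∧ y ∈ V q b

theorem le_condK_of_not_compressible {V : List Bool → List Bool →. List Bool} {b y : List Bool}
    (h : ¬ Compressible V b y) : ((y.length - 6 : ℕ) : ℕ∞) ≤ condK V y b := by
  refine le_iInf₂ fun q hq => ?_
  by_contra! hlt
  refine h ⟨q, ?_, hq⟩
  have := Nat.cast_lt.1 hlt
  omega

theorem card_le_of_compressible {V : List Bool → List Bool →. List Bool} {b : List Bool} {n : ℕ}
    (B : Finset (List Bool)) (hB : ∀ y ∈ B, y.length = n ∧ Compressible V b y) :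
    B.card ≤ 2 ^ (n - 6) := by
  classical
  have hq : ∀ y : List Bool, ∃ q : List Bool, y ∈ B → q.length + 6 < n ∧ y ∈ V q b := by
    intro y
    by_cases hy : y ∈ B
    · obtain ⟨hn, q, h1, h2⟩ := hB y hy
      exact ⟨q, fun _ => ⟨hn ▸ h1, h2⟩⟩
    · exact ⟨[], fun h => absurd h hy⟩
  choose q hq using hq
  rw [← Finset.card_image_of_injOn (f := q) (s := B) fun y hy y' hy' h =>
    Part.mem_unique (hq y hy).2 (h ▸ (hq y' hy').2)]
  refine card_le_of_length_lt _ _ fun l hl => ?_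
  obtain ⟨y, hy, rfl⟩ := Finset.mem_image.1 hl
  have := (hq y hy).1
  omega

theorem exists_computable_stage_program (c : Nat.Partrec.Code) :
    ∃ acc : (List Bool × List Bool) × ℕ → ℕ → Bool, Computable₂ acc ∧
      ∀ b y k z, acc ((b, y), k) z = true ↔ ∃ q : List Bool, Encodable.decode z = some q ∧
        q.length + 6 < y.length ∧
        Encodable.encode y ∈ Nat.Partrec.Code.evaln k c (Encodable.encode (q, b)) := by
  let good : (List Bool × List Bool) × ℕ → List Bool → Bool := fun a q =>
    decide (q.length + 6 < a.1.2.length) &&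
      decide (Nat.Partrec.Code.evaln a.2 c (Encodable.encode (q, a.1.1))
        = some (Encodable.encode a.1.2))
  have hgood : Primrec₂ fun (a : ((List Bool × List Bool) × ℕ) × ℕ) (q : List Bool) =>
      good a.1 q := by
    have hb : Primrec fun a : (((List Bool × List Bool) × ℕ) × ℕ) × List Bool => a.1.1.1.1 :=
      Primrec.fst.comp (Primrec.fst.comp (Primrec.fst.comp .fst))
    have hy : Primrec fun a : (((List Bool × List Bool) × ℕ) × ℕ) × List Bool => a.1.1.1.2 :=
      Primrec.snd.comp (Primrec.fst.comp (Primrec.fst.comp .fst))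
    have hk : Primrec fun a : (((List Bool × List Bool) × ℕ) × ℕ) × List Bool => a.1.1.2 :=
      Primrec.snd.comp (Primrec.fst.comp .fst)
    exact Primrec.and.comp
      (Primrec.nat_lt.decide.comp (Primrec.nat_add.comp (Primrec.list_length.comp .snd)
        (.const 6)) (Primrec.list_length.comp hy))
      (Primrec.eq.decide.comp (Nat.Partrec.Code.primrec_evaln.comp
        (Primrec.pair (Primrec.pair hk (.const c)) (Primrec.encode.comp (Primrec.pair .snd hb))))
        (Primrec.option_some.comp (Primrec.encode.comp hy)))
  let acc : (List Bool × List Bool) × ℕ → ℕ → Bool := fun a z =>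
    Option.casesOn (Encodable.decode (α := List Bool) z) false fun q => good a q
  have hacc : Computable₂ acc :=
    (Primrec.option_casesOn (Primrec.decode.comp Primrec.snd) (.const false) hgood).to_comp
  refine ⟨acc, hacc, fun b y k z => ?_⟩
  simp only [acc]
  cases hd : Encodable.decode (α := List Bool) z with
  | none => simp
  | some q =>
    simp only [good, Bool.and_eq_true, Option.some.injEq, exists_eq_left', Option.mem_def]
    exact and_congr decide_eq_true_iff decide_eq_true_iff

/-- Stage `k` bounds both the code of the program tried and the running time, which makes it
decidable and monotone in `k`. -/
theorem exists_compressible_stages {V : List Bool → List Bool →. List Bool} (hV : Partrec₂ V) :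
    ∃ A : List Bool × List Bool → ℕ → Bool, Computable₂ A ∧
      (∀ a k k', k ≤ k' → A a k = true → A a k' = true) ∧
      ∀ b y, Compressible V b y ↔ ∃ k, A (b, y) k = true := by
  obtain ⟨c, hc⟩ := exists_code_evaln hV
  obtain ⟨acc, hacc, hacc_iff⟩ := exists_computable_stage_program c
  let A : List Bool × List Bool → ℕ → Bool := fun a k =>
    decide (0 < Nat.count (fun z => acc (a, k) z = true) k)
  have hA_iff : ∀ a k, A a k = true ↔ ∃ z < k, acc (a, k) z = true := by
    intro a k
    simp only [A, decide_eq_true_eq, Nat.count_eq_card_filter_range, Finset.card_pos]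
    constructor
    · rintro ⟨z, hz⟩
      obtain ⟨h1, h2⟩ := Finset.mem_filter.1 hz
      exact ⟨z, Finset.mem_range.1 h1, h2⟩
    · rintro ⟨z, h1, h2⟩
      exact ⟨z, Finset.mem_filter.2 ⟨Finset.mem_range.2 h1, h2⟩⟩
  refine ⟨A, ?_, ?_, fun b y => ?_⟩
  · have h := (computable_count hacc).comp (Computable.id (α := (List Bool × List Bool) × ℕ)) .snd
    exact Primrec.nat_lt.decide.to_comp.comp (Computable.const 0) h
  · rintro ⟨b, y⟩ k k' hk h
    obtain ⟨z, hz, h⟩ := (hA_iff (b, y) k).1 h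
    obtain ⟨q, h1, h2, h3⟩ := (hacc_iff b y k z).1 h
    exact (hA_iff (b, y) k').2 ⟨z, hz.trans_le hk,
      (hacc_iff b y k' z).2 ⟨q, h1, h2, Nat.Partrec.Code.evaln_mono hk h3⟩⟩
  · constructor
    · rintro ⟨q, hq, hy⟩
      obtain ⟨k, hk⟩ := (hc (q, b) y).1 hy
      refine ⟨max k (Encodable.encode q + 1), (hA_iff (b, y) _).2 ⟨Encodable.encode q,
        lt_max_of_lt_right (Nat.lt_succ_self _),
        (hacc_iff b y _ _).2 ⟨q, Encodable.encodek q, hq, ?_⟩⟩⟩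
      exact Nat.Partrec.Code.evaln_mono (le_max_left _ _) hk
    · rintro ⟨k, hk⟩
      obtain ⟨z, -, h⟩ := (hA_iff (b, y) k).1 hk
      obtain ⟨q, -, h2, h3⟩ := (hacc_iff b y k z).1 h
      exact ⟨q, h2, (hc (q, b) y).2 ⟨k, h3⟩⟩

open Classical in
/-- At least half of the hashes of `x` with seeds of length `l` are compressible given `b`. -/
def MostlyCompressible (V : List Bool → List Bool →. List Bool) (b : List Bool) (l : ℕ)
    (x : List Bool) : Prop :=
  2 ^ l ≤ 2 * ((Finset.range (2 ^ l)).filter fun s =>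
    Compressible V b (seedHash (natWord l s) x)).card

theorem exists_enumeration_mostlyCompressible {V : List Bool → List Bool →. List Bool}
    (hV : Partrec₂ V) {m : ℕ → ℕ} (hm : Computable m) :
    ∃ G : List Bool → ℕ → Option (List Bool), Computable₂ G ∧ ∀ b x,
      (∃ z, G b z = some x) ↔ x.length = wordVal b.reverse ∧
        MostlyCompressible V b (m (wordVal b.reverse)) x := by
  classical
  obtain ⟨A, hA, hmono, hcomp⟩ := exists_compressible_stages hV
  let len : List Bool → ℕ := fun b => m (wordVal b.reverse)
  have hn : Computable fun b : List Bool => wordVal b.reverse :=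
    (primrec_wordVal.comp Primrec.list_reverse).to_comp
  have hlen : Computable len := hm.comp hn
  let hit : List Bool × (ℕ × List Bool) → ℕ → Bool := fun a s =>
    A (a.1, seedHash (natWord (len a.1) s) a.2.2) a.2.1
  have hhit : Computable₂ hit := by
    have h1 : Computable fun a : (List Bool × (ℕ × List Bool)) × ℕ => a.1.1 :=
      Computable.fst.comp .fst
    have h2 : Computable fun a : (List Bool × (ℕ × List Bool)) × ℕ => a.1.2.2 :=
      Computable.snd.comp (Computable.snd.comp .fst)
    have h3 : Computable fun a : (List Bool × (ℕ × List Bool)) × ℕ => a.1.2.1 :=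
      Computable.fst.comp (Computable.snd.comp .fst)
    exact hA.comp (Computable.pair h1 (primrec_seedHash.to_comp.comp
      (primrec_natWord.to_comp.comp (hlen.comp h1) .snd) h2)) h3
  let test : List Bool × (ℕ × List Bool) → Bool := fun a =>
    decide (a.2.2.length = wordVal a.1.reverse) &&
      decide (2 ^ len a.1 ≤ 2 * Nat.count (fun s => hit a s = true) (2 ^ len a.1))
  have hpow : Computable fun a : List Bool × (ℕ × List Bool) => 2 ^ len a.1 :=
    primrec_nat_pow.to_comp.comp (Computable.const 2) (hlen.comp .fst)
  have htest : Computable test :=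
    Primrec.and.to_comp.comp
      (Primrec.eq.decide.to_comp.comp
        (Computable.list_length.comp (Computable.snd.comp .snd)) (hn.comp .fst))
      (Primrec.nat_le.decide.to_comp.comp hpow (Primrec.nat_mul.to_comp.comp (Computable.const 2)
        ((computable_count hhit).comp .id hpow)))
  let G : List Bool → ℕ → Option (List Bool) := fun b z =>
    (Encodable.decode (α := ℕ × List Bool) z).bind fun a => cond (test (b, a)) (some a.2) none
  have hG : Computable₂ G := by
    refine Computable.option_bind (Computable.decode.comp .snd) ?_
    exact Computable.cond (htest.comp (Computable.pair (Computable.fst.comp .fst) .snd))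
      (Computable.option_some.comp (Computable.snd.comp .snd)) (Computable.const none)
  have hG_iff : ∀ b x, (∃ z, G b z = some x) ↔ ∃ k, test (b, k, x) = true := by
    intro b x
    constructor
    · rintro ⟨z, hz⟩
      obtain ⟨⟨k, y⟩, -, h⟩ := Option.bind_eq_some_iff.1 hz
      cases ht : test (b, k, y) with
      | false => simp [ht] at h
      | true =>
        rw [ht, cond_true] at h
        exact ⟨k, Option.some.inj h ▸ ht⟩
    · rintro ⟨k, hk⟩
      exact ⟨Encodable.encode (k, x), by simp [G, hk]⟩
  refine ⟨G, hG, fun b x => (hG_iff b x).trans ?_⟩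
  simp only [test, Bool.and_eq_true, decide_eq_true_eq, exists_and_left, MostlyCompressible,
    Nat.count_eq_card_filter_range]
  refine and_congr_right fun _ => ⟨?_, fun h => ?_⟩
  · rintro ⟨k, hk⟩
    refine hk.trans (Nat.mul_le_mul_left _ (Finset.card_le_card fun s hs => ?_))
    obtain ⟨h1, h2⟩ := Finset.mem_filter.1 hs
    exact Finset.mem_filter.2 ⟨h1, (hcomp _ _).2 ⟨k, h2⟩⟩
  · set S := (Finset.range (2 ^ m (wordVal b.reverse))).filter fun s =>
      Compressible V b (seedHash (natWord (m (wordVal b.reverse)) s) x) with hS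
    -- Finitely many seeds and monotone stages: one stage certifies all of them.
    have hev : ∀ᶠ k in Filter.atTop, ∀ s ∈ S,
        A (b, seedHash (natWord (m (wordVal b.reverse)) s) x) k = true := by
      refine (Filter.eventually_all_finset S).2 fun s hs => ?_
      obtain ⟨k, hk⟩ := (hcomp _ _).1 (Finset.mem_filter.1 hs).2
      exact Filter.eventually_atTop.2 ⟨k, fun k' hk' => hmono _ _ _ hk' hk⟩
    obtain ⟨k, hk⟩ := hev.exists
    refine ⟨k, h.trans (Nat.mul_le_mul_left _ (Finset.card_le_card fun s hs => ?_))⟩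
    exact Finset.mem_filter.2 ⟨(Finset.mem_filter.1 hs).1, hk s hs⟩

theorem plainK_le_of_mostlyCompressible {U : List Bool →. List Bool} (hU : IsUniversal U)
    {V : List Bool → List Bool →. List Bool} (hV : Partrec₂ V) {m : ℕ → ℕ} (hm : Computable m) :
    ∃ c : ℕ, ∀ n, 6 ≤ n → m n ≤ n → n ≤ 2 * m n → ∀ x : List Bool, x.length = n →
      MostlyCompressible V (binString n) (m n) x →
        plainK U x ≤ (2 * Nat.size n + (n - m n) + c : ℕ) := by
  classical
  obtain ⟨G, hG, hGx⟩ := exists_enumeration_mostlyCompressible hV hm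
  obtain ⟨c, hc⟩ := plainK_le_of_enumeration hU hG
  refine ⟨c, fun n h6 hmn hnm x hx hmx => ?_⟩
  have hb : wordVal (binString n).reverse = n := by
    rw [binString, List.reverse_reverse, wordVal_bits]
  have hfin : ∀ p : List Bool → Prop, {y : List Bool | y.length = n ∧ p y}.Finite := fun p =>
    (List.finite_length_eq Bool n).subset fun y hy => hy.1
  let X := (hfin (MostlyCompressible V (binString n) (m n))).toFinset
  let B := (hfin (Compressible V (binString n))).toFinset
  have hXcard : X.card ≤ 2 ^ (n - m n) := by
    refine card_le_of_seedHash_mem h6 hmn hnm B X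
      (card_le_of_compressible (V := V) (b := binString n) B fun y hy => by simpa [B] using hy)
      (fun y hy => ?_) fun y hy => ?_
    · exact ((Set.Finite.mem_toFinset _).1 hy).1
    · obtain ⟨h1, h2⟩ := (Set.Finite.mem_toFinset _).1 hy
      refine h2.trans (Nat.mul_le_mul_left _ (Finset.card_le_card fun s hs => ?_))
      obtain ⟨hs1, hs2⟩ := Finset.mem_filter.1 hs
      refine Finset.mem_filter.2 ⟨hs1, (Set.Finite.mem_toFinset _).2 ⟨?_, hs2⟩⟩
      rw [length_seedHash (by simpa [h1] using hmn), h1]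
  obtain ⟨z, hz⟩ := (hGx (binString n) x).2 (by rw [hb]; exact ⟨hx, hmx⟩)
  have := hc (binString n) (n - m n) X hXcard (fun w y hw => by
    have hy := (hGx (binString n) y).1 ⟨w, hw⟩
    rw [hb] at hy
    exact (Set.Finite.mem_toFinset _).2 hy) z x hz
  rwa [show (binString n).length = Nat.size n by
    rw [binString, List.length_reverse, Nat.size_eq_bits_len]] at this

/-! ### The main theorem -/

theorem exists_condK_seedHash_le {V : List Bool → List Bool →. List Bool}
    (hV : IsCondUniversal V) :
    ∃ c : ℕ, ∀ s x : List Bool, condK V (seedHash s x) x ≤ (s.length + c : ℕ) := by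
  obtain ⟨c, hc⟩ := hV.2 (fun s x => Part.some (seedHash s x)) primrec_seedHash.to_comp.partrec
  refine ⟨c, fun s x => (hc _ x).trans ?_⟩
  push_cast
  gcongr
  exact iInf₂_le (f := fun (p : List Bool) _ => (p.length : ℕ∞)) s (Part.mem_some _)

theorem two_pow_le_ncard_depSet {V : List Bool → List Bool →. List Bool}
    (hV : IsCondUniversal V) {c n l a : ℕ}
    (hc : ∀ s x : List Bool, condK V (seedHash s x) x ≤ (s.length + c : ℕ))
    (hn : l + (a + (6 + c)) = n) {x : List Bool} (hx : x.length = n)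
    (hmx : ¬ MostlyCompressible V (binString n) l x) :
    2 ^ l ≤ 2 * (depSet V x a).ncard := by
  classical
  set S := (Finset.range (2 ^ l)).filter fun s =>
    ¬ Compressible V (binString n) (seedHash (natWord l s) x) with hS
  have hcard := Finset.card_filter_add_card_filter_not (s := Finset.range (2 ^ l))
    (fun s => Compressible V (binString n) (seedHash (natWord l s) x))
  rw [Finset.card_range, ← hS] at hcard
  have hlt := not_le.1 hmx
  have hfin : (depSet V x a).Finite :=
    (List.finite_length_eq Bool x.length).subset fun y hy => hy.1
  have hsub : ((S.image fun s => seedHash (natWord l s) x : Finset (List Bool)) : Set (List Bool))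
      ⊆ depSet V x a := by
    intro y hy
    obtain ⟨s, hs, rfl⟩ := Finset.mem_image.1 (Finset.mem_coe.1 hy)
    have hlen : (seedHash (natWord l s) x).length = x.length :=
      length_seedHash (by rw [length_natWord]; omega)
    refine ⟨hlen, ?_⟩
    have h1 := le_condK_of_not_compressible (Finset.mem_filter.1 hs).2
    have h2 := hc (natWord l s) x
    rw [hlen, hx] at h1
    rw [length_natWord] at h2
    rw [hx]
    obtain ⟨u, hu⟩ := ENat.ne_top_iff_exists.1
      (condK_ne_top hV (seedHash (natWord l s) x) (binString n))
    obtain ⟨v, hv⟩ := ENat.ne_top_iff_exists.1 (condK_ne_top hV (seedHash (natWord l s) x) x)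
    rw [← hu] at h1 ⊢
    rw [← hv] at h2 ⊢
    have h1' := Nat.cast_le.1 h1
    have h2' := Nat.cast_le.1 h2
    simp only [ENat.toNat_natCast]
    omega
  have hle := Set.ncard_le_ncard hsub hfin
  rw [Set.ncard_coe_finset, Finset.card_image_of_injOn] at hle
  · unfold MostlyCompressible at hmx
    omega
  · intro s hs t ht hst
    have := congrArg wordVal (seedHash_left_injective (by simp) hst)
    rwa [wordVal_natWord (Finset.mem_range.1 (Finset.mem_filter.1 hs).1),
      wordVal_natWord (Finset.mem_range.1 (Finset.mem_filter.1 ht).1)] at this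

theorem size_le_logb_add_one {n : ℕ} (hn : 0 < n) : (Nat.size n : ℝ) ≤ Real.logb 2 n + 1 := by
  have h0 : 0 < Nat.size n := Nat.size_pos.2 hn
  have h1 : 2 ^ (Nat.size n - 1) ≤ n := Nat.lt_size.1 (by omega)
  have h2 : ((Nat.size n - 1 : ℕ) : ℝ) ≤ Real.logb 2 n := by
    rw [Real.le_logb_iff_rpow_le (by norm_num) (by exact_mod_cast hn), Real.rpow_natCast]
    exact_mod_cast h1
  rw [Nat.cast_sub h0] at h2
  push_cast at h2
  linarith

theorem mainTheorem1
    (U : List Bool →. List Bool) (hU : IsUniversal U)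
    (V : List Bool → List Bool →. List Bool) (hV : IsCondUniversal V) :
    ∃ c : ℝ, 0 < c ∧ ∀ α : ℕ → ℕ, Computable α →
      ∀ᶠ n : ℕ in Filter.atTop, ∀ x : List Bool, x.length = n →
        (α n : ℝ) + 8 * Real.logb 2 (n : ℝ) ≤ ((plainK U x).toNat : ℝ) →
          1 / c * (2 : ℝ) ^ ((n : ℤ) - (α n : ℤ)) - (n : ℝ) ^ 8 * (2 : ℝ) ^ (α n)
            ≤ ((depSet V x (α n)).ncard : ℝ) := by
  obtain ⟨cV, hcV⟩ := exists_condK_seedHash_le hV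
  set d := 6 + cV with hd
  -- The factor `2^d` pays for the shortening of the seed by `d`, and the extra 2 for keeping only
  -- half of the seeds.
  refine ⟨2 ^ (d + 1), by positivity, fun α hα => ?_⟩
  have hm : Computable fun n => n - (α n + d) :=
    Primrec.nat_sub.to_comp.comp .id (Primrec.nat_add.to_comp.comp hα (Computable.const d))
  obtain ⟨cU, hcU⟩ := plainK_le_of_mostlyCompressible hU hV.1 hm
  have hlog : Filter.Tendsto (fun n : ℕ => Real.logb 2 (n : ℝ)) Filter.atTop Filter.atTop :=
    (Real.tendsto_logb_atTop (by norm_num)).comp tendsto_natCast_atTop_atTop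
  filter_upwards [Filter.eventually_ge_atTop (2 ^ d), Filter.eventually_ge_atTop 6,
    hlog.eventually_gt_atTop ((d + cU + 2 : ℕ) : ℝ)] with n hnd hn6 hnlog x hx hCx
  -- In the first case `n - α n ≤ α n + 2 * d`, and `2^d ≤ n` makes the left side nonpositive.
  rcases lt_or_ge n (2 * (α n + d)) with hsmall | hlarge
  · have h1 : (2 : ℝ) ^ ((n : ℤ) - (α n : ℤ)) ≤ 2 ^ (α n) * 2 ^ (2 * d) := by
      rw [← pow_add, ← zpow_natCast]
      exact zpow_le_zpow_right₀ (by norm_num) (by push_cast; omega)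
    have h2 : (2 : ℝ) ^ d ≤ (n : ℝ) ^ 8 := by
      have h3 : (2 : ℝ) ^ d ≤ n := by exact_mod_cast hnd
      exact h3.trans (le_self_pow₀ (by exact_mod_cast (by omega : 1 ≤ n)) (by norm_num))
    refine le_trans ?_ (Nat.cast_nonneg _)
    rw [sub_nonpos]
    calc 1 / (2 : ℝ) ^ (d + 1) * (2 : ℝ) ^ ((n : ℤ) - (α n : ℤ))
        ≤ 1 / (2 : ℝ) ^ (d + 1) * (2 ^ (α n) * 2 ^ (2 * d)) := by gcongr
      _ = 2 ^ d * 2 ^ (α n) / 2 := by field_simp; ring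
      _ ≤ 2 ^ d * 2 ^ (α n) := half_le_self (by positivity)
      _ ≤ (n : ℝ) ^ 8 * 2 ^ (α n) := by gcongr
  · obtain ⟨l, hl⟩ : ∃ l, n - (α n + d) = l := ⟨_, rfl⟩
    have hln : l + (α n + d) = n := by omega
    have hmx : ¬ MostlyCompressible V (binString n) l x := by
      intro h
      have h1 := hcU n hn6 (Nat.sub_le _ _) (by omega) x hx (by rw [hl]; exact h)
      have h2 : (plainK U x).toNat ≤ 2 * Nat.size n + (n - (n - (α n + d))) + cU :=
        (ENat.toNat_le_toNat h1 (ENat.natCast_ne_top _)).trans_eq (ENat.toNat_natCast _)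
      rw [show n - (n - (α n + d)) = α n + d by omega] at h2
      have h3 : ((plainK U x).toNat : ℝ) ≤ 2 * (Nat.size n : ℝ) + (α n + d) + cU := by
        exact_mod_cast h2
      have h4 := size_le_logb_add_one (n := n) (by omega)
      -- The description costs at most `α n + 2 log n + (d + cU + 2)`, which is below `α n + 3 log
      -- n` by the choice of `n`.
      push_cast at hnlog
      have h5 : (0 : ℝ) ≤ d + cU + 2 := by positivity
      linarith
    have hcount := two_pow_le_ncard_depSet hV hcV hln hx hmx
    have hcount' : (2 : ℝ) ^ l ≤ 2 * ((depSet V x (α n)).ncard : ℝ) := by exact_mod_cast hcount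
    have h1 : (n : ℤ) - (α n : ℤ) = ((l + d : ℕ) : ℤ) := by push_cast; omega
    have h2 : 1 / (2 : ℝ) ^ (d + 1) * (2 : ℝ) ^ ((n : ℤ) - (α n : ℤ)) = 2 ^ l / 2 := by
      rw [h1, zpow_natCast, pow_add, pow_succ]
      field_simp
      ring
    have h3 : (0 : ℝ) ≤ (n : ℝ) ^ 8 * 2 ^ (α n) := by positivity
    rw [h2]
    linarith
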